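/- Let $L$ be a relational language (with arbitrarily many relation symbols, each of finite arity) containing a distinguished binary relation symbol $\leq$. An $L$-structure $\mathbf{M}$ with vertex set $M$ is called \emph{ordered} if the interpretation $\leq_{\mathbf{M}}$ is a linear order on $M$. For $L$-structures $\mathbf{A}, \mathbf{B}$, let $\mathrm{Emb}(\mathbf{A},\mathbf{B})$ be the set of embeddings $\mathbf{A}\to\mathbf{B}$, that is, injective maps that preserve every relation of $L$ in both directions. For $L$-structures $\mathbf{A},\mathbf{B},\mathbf{C}$, write $\mathbf{C}\longrightarrow(\mathbf{B})^{\mathbf{A}}_2$ if for every colouring $\chi\colon \mathrm{Emb}(\mathbf{A},\mathbf{C})\to\{0,1\}$ there exists $f\in \mathrm{Emb}(\mathbf{B},\mathbf{C})$ such that $\chi$ is constant on $\{f\circ g : g\in\mathrm{Emb}(\mathbf{A},\mathbf{B})\}$. \textbf{Theorem} (Ne\v{s}et\v{r}il--R\"odl, Abramson--Harrington, unrestricted form). Let $\mathbf{A}$ and $\mathbf{B}$ be finite ordered $L$-structures. Then there exists a finite ordered $L$-structure $\mathbf{C}$ such that $\mathbf{C}\longrightarrow(\mathbf{B})^{\mathbf{A}}_2$.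 -/

import Mathlib

open scoped FirstOrder

namespace StructuralRamsey

open FirstOrder FirstOrder.Language FirstOrder.Language.Structure

/-- For a language `L` with a distinguished binary relation symbol `≤` (`leSymb`), an
`L`-structure `M` is *ordered* if the interpretation of `≤` is a (reflexive) linear order
on the vertex set `M`. -/
def IsOrderedStructure (L : FirstOrder.Language) [L.IsOrdered] (M : Type*) [L.Structure M] :
    Prop :=
  IsLinearOrder M (fun x y => RelMap (leSymb : L.Relations 2) ![x, y])

/-- The Erdős–Rado partition arrow `C ⟶ (B)^A_2`: for every 2-colouring `χ` of the embeddings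
of `A` into `C` there is an embedding `f` of `B` into `C` such that `χ` is constant on
`{f ∘ g : g ∈ Emb(A, B)}`. -/
def PartitionArrow (L : FirstOrder.Language) (C B A : Type*)
    [L.Structure C] [L.Structure B] [L.Structure A] : Prop :=
  ∀ χ : (A ↪[L] C) → Fin 2, ∃ f : B ↪[L] C, ∃ c : Fin 2, ∀ g : A ↪[L] B, χ (f.comp g) = c

end StructuralRamsey

namespace StructuralRamsey

open FirstOrder FirstOrder.Language FirstOrder.Language.Structure

/-! This is the partite construction, driven by Hales–Jewett. Start from disjoint copies of `B`, one
above each order embedding `B ↪o Fin N`. For each injection `s : A ↪ Fin N` in turn,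
`exists_partite_extension` enlarges the system so that, inside a copy of the old one, all copies of
`A` above `s` get one colour. In the end the colour of a copy depends only on its projection, and
finite Ramsey, which supplied `N`, picks a good copy of `B`. Structures are treated as colourings of
tuples; the order is put back at the end, from the projection. -/

/-- The finite Ramsey theorem for sets, uniformly over the finite subsets of a linear order. -/
theorem exists_monochromatic_powersetCard (α : Type*) [LinearOrder α] (k : ℕ) :
    ∀ n : ℕ, ∃ N : ℕ, ∀ S : Finset α, N ≤ S.card → ∀ χ : Finset α → Fin 2,
      ∃ T ⊆ S, T.card = n ∧ ∃ c, ∀ U ⊆ T, U.card = k → χ U = c := by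
  induction k with
  | zero =>
    intro n
    refine ⟨n, fun S hS χ => ?_⟩
    obtain ⟨T, hT, hc⟩ := Finset.exists_subset_card_eq hS
    refine ⟨T, hT, hc, χ ∅, fun U _ hU => ?_⟩
    rw [Finset.card_eq_zero.1 hU]
  | succ k ih =>
    -- End-homogeneity: the colour of a `(k+1)`-subset depends only on its least element. Pigeonhole
    -- on `d` then costs a factor 2.
    have key : ∀ m : ℕ, ∃ N : ℕ, ∀ S : Finset α, N ≤ S.card → ∀ χ : Finset α → Fin 2,
        ∃ T ⊆ S, T.card = m ∧ ∃ d : α → Fin 2, ∀ x ∈ T, ∀ U ⊆ T, U.card = k →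
          (∀ y ∈ U, x < y) → χ (insert x U) = d x := by
      intro m
      induction m with
      | zero =>
        refine ⟨0, fun S _ χ => ⟨∅, by simp, rfl, fun _ => 0, by simp⟩⟩
      | succ m ihm =>
        obtain ⟨N₁, hN₁⟩ := ihm
        obtain ⟨N₂, hN₂⟩ := ih N₁
        refine ⟨N₂ + 1, fun S hS χ => ?_⟩
        have hne : S.Nonempty := Finset.card_pos.1 (by omega)
        set a := S.min' hne with ha
        have haS : a ∈ S := S.min'_mem hne
        obtain ⟨S₁, hS₁, hc₁, c, hc⟩ := hN₂ (S.erase a)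
          (by rw [Finset.card_erase_of_mem haS]; omega) (fun U => χ (insert a U))
        obtain ⟨T, hT, hTc, d, hd⟩ := hN₁ S₁ hc₁.ge χ
        have hlt : ∀ y ∈ T, a < y := fun y hy => by
          have := hS₁ (hT hy)
          exact lt_of_le_of_ne (S.min'_le y (Finset.mem_of_mem_erase this))
            (Finset.ne_of_mem_erase this).symm
        have haT : a ∉ T := fun h => lt_irrefl _ (hlt a h)
        refine ⟨insert a T, ?_, by rw [Finset.card_insert_of_notMem haT, hTc],
          fun x => if x = a then c else d x, ?_⟩
        · refine Finset.insert_subset haS fun y hy => ?_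
          exact Finset.mem_of_mem_erase (hS₁ (hT hy))
        · intro x hx U hU hUc hxU
          have haU : a ∉ U := fun h => by
            have h1 := hxU a h
            rcases Finset.mem_insert.1 hx with rfl | hx
            · exact lt_irrefl _ h1
            · exact lt_asymm h1 (hlt x hx)
          have hUT : U ⊆ T := (Finset.subset_insert_iff_of_notMem haU).1 hU
          by_cases hxa : x = a
          · subst hxa
            simp only [if_true]
            exact hc U (hUT.trans hT) hUc
          · simp only [if_neg hxa]
            exact hd x ((Finset.mem_insert.1 hx).resolve_left hxa) U hUT hUc hxU
    intro n
    obtain ⟨N, hN⟩ := key (2 * n)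
    refine ⟨N, fun S hS χ => ?_⟩
    obtain ⟨T, hT, hTc, d, hd⟩ := hN S hS χ
    obtain ⟨c, -, hc⟩ := Finset.exists_le_card_fiber_of_mul_le_card_of_maps_to
      (s := T) (t := (Finset.univ : Finset (Fin 2))) (f := d) (n := n)
      (fun _ _ => Finset.mem_univ _) Finset.univ_nonempty (by simp [hTc])
    obtain ⟨V, hV, hVc⟩ := Finset.exists_subset_card_eq hc
    refine ⟨V, (hV.trans (Finset.filter_subset _ _)).trans hT, hVc, c, fun U hU hUc => ?_⟩
    have hne : U.Nonempty := Finset.card_pos.1 (by omega)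
    have hm := U.min'_mem hne
    have hUT : U ⊆ T := (hU.trans hV).trans (Finset.filter_subset _ _)
    have h := hd (U.min' hne) (hUT hm) (U.erase (U.min' hne))
      ((Finset.erase_subset _ _).trans hUT) (by rw [Finset.card_erase_of_mem hm, hUc]; rfl)
      (fun y hy => lt_of_le_of_ne (U.min'_le y (Finset.mem_of_mem_erase hy))
        (Finset.ne_of_mem_erase hy).symm)
    rw [Finset.insert_erase hm] at h
    rw [h]
    exact (Finset.mem_filter.1 (hV (hU hm))).2

/-- The finite Ramsey theorem for order embeddings between finite linear orders. -/
theorem exists_monochromatic_orderEmbedding (A B : Type*) [LinearOrder A] [LinearOrder B]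
    [Fintype A] [Fintype B] :
    ∃ N : ℕ, ∀ χ : (A ↪o Fin N) → Fin 2,
      ∃ t : B ↪o Fin N, ∃ c, ∀ g : A ↪o B, χ (g.trans t) = c := by
  classical
  obtain ⟨N, hN⟩ := exists_monochromatic_powersetCard ℕ (Fintype.card A) (Fintype.card B)
  let eA := Fintype.orderIsoFinOfCardEq A rfl
  let eB := Fintype.orderIsoFinOfCardEq B rfl
  refine ⟨N, fun χ => ?_⟩
  -- An order embedding is determined by its image, so `χ` becomes a colouring of sets; the value 0
  -- on non-images is never used.
  obtain ⟨T, hT, hTc, c, hc⟩ := hN (Finset.range N) (by simp) fun U =>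
    if h : ∃ s : A ↪o Fin N, Finset.univ.image (fun a => (s a : ℕ)) = U then χ h.choose else 0
  have hTN : ∀ i, T.orderEmbOfFin hTc i < N := fun i =>
    Finset.mem_range.1 (hT (T.orderEmbOfFin_mem hTc i))
  let t : B ↪o Fin N := OrderEmbedding.ofStrictMono
    (fun b => ⟨T.orderEmbOfFin hTc (eB.symm b), hTN _⟩) fun b b' h => by
      simpa [Fin.lt_def] using h
  refine ⟨t, c, fun g => ?_⟩
  set U : Finset ℕ := Finset.univ.image (fun a => (g.trans t a : ℕ)) with hU
  have hinj : ∀ s : A ↪o Fin N, Function.Injective fun a => (s a : ℕ) := fun s =>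
    Fin.val_injective.comp s.injective
  have hUc : U.card = Fintype.card A := by
    rw [hU, Finset.card_image_of_injective _ (hinj _), Finset.card_univ]
  have hUT : U ⊆ T := by
    intro x hx
    obtain ⟨a, -, rfl⟩ := Finset.mem_image.1 hx
    exact T.orderEmbOfFin_mem hTc _
  have hex : ∃ s : A ↪o Fin N, Finset.univ.image (fun a => (s a : ℕ)) = U := ⟨g.trans t, rfl⟩
  have h := hc U hUT hUc
  rw [dif_pos hex] at h
  rw [← h]
  congr 1
  have huniq : ∀ s : A ↪o Fin N, Finset.univ.image (fun a => (s a : ℕ)) = U →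
      (fun i => (s (eA i) : ℕ)) = U.orderEmbOfFin hUc := fun s hs =>
    Finset.orderEmbOfFin_unique hUc
      (fun i => hs ▸ Finset.mem_image_of_mem _ (Finset.mem_univ _))
      (fun i j hij => by simpa using hij)
  ext a
  have := congrFun ((huniq _ rfl).trans (huniq _ hex.choose_spec).symm) (eA.symm a)
  simpa using this

/-! ### Partite construction -/

/-- One step of the partite construction, for structures given by colourings `c` of tuples:
over a single transversal `s : A → I`, colourings of the copies of `A` above `s`
can be made constant on a copy of `P`. -/
theorem exists_partite_extension {κ : ℕ → Type*} [∀ n, Inhabited (κ n)] {A : Type*} [Finite A]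
    (cA : ∀ n, (Fin n → A) → κ n) {I P : Type} [Finite I] [Finite P]
    (π : P → I) (c : ∀ n, (Fin n → P) → κ n) (s : A → I) (hs : Function.Injective s) :
    ∃ (P' : Type) (_ : Finite P') (π' : P' → I) (c' : ∀ n, (Fin n → P') → κ n),
      ∀ χ : (A → P') → Fin 2, ∃ φ : P → P', (∀ p, π' (φ p) = π p) ∧
        (∀ n v, c' n (φ ∘ v) = c n v) ∧
        ∃ k, ∀ e : A → P, (∀ a, π (e a) = s a) → (∀ n v, c n (e ∘ v) = cA n v) →
          χ (φ ∘ e) = k := by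
  classical
  let E := {e : A → P // (∀ a, π (e a) = s a) ∧ ∀ n v, c n (e ∘ v) = cA n v}
  obtain ⟨ι, _, hι⟩ := Combinatorics.Line.exists_mono_in_high_dimension E (Fin 2)
  -- A tuple `u` of `P` is informative if it is a coordinate of `x` and its colour
  -- is not already determined by its projection.
  let Inf (n : ℕ) (x : Fin n → I × (ι → Option P)) (u : Fin n → P) : Prop :=
    (∃ i, ∀ j, (x j).2 i = some (u j)) ∧
      ∀ a : Fin n → A, (∀ j, s (a j) = (x j).1) → c n u ≠ cA n a
  -- `default` is never met on the image of `φ` below: a tuple projecting outside the range of `s`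
  -- is informative there.
  let c' (n : ℕ) (x : Fin n → I × (ι → Option P)) : κ n :=
    if h : ∃ u, Inf n x u then c n h.choose
    else if h : ∃ a : Fin n → A, ∀ j, s (a j) = (x j).1 then cA n h.choose
    else default
  have hinv := hs.isPartialInv
  refine ⟨I × (ι → Option P), inferInstance, Prod.fst, c', fun χ => ?_⟩
  obtain ⟨l, k, hl⟩ := hι fun w => χ fun a => (s a, fun i => some ((w i).1 a))
  -- Active coordinates of the line record `p`; a fixed coordinate `e` records the point of the copy
  -- `e` in the part of `p`, if there is one.
  let φ (p : P) : I × (ι → Option P) := (π p, fun i =>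
    (l.idxFun i).elim (some p) fun e => (Function.partialInv s (π p)).map e.1)
  refine ⟨φ, fun _ => rfl, fun n v => ?_, k, fun e he hc => ?_⟩
  · have huniq : ∀ u, Inf n (φ ∘ v) u → u = v := by
      rintro u ⟨⟨i, hi⟩, hu⟩
      rcases hw : l.idxFun i with _ | e
      · funext j
        have := hi j
        simp only [φ, Function.comp_apply, hw, Option.elim_none, Option.some.injEq] at this
        exact this.symm
      · exfalso
        have h : ∀ j, ∃ a, s a = π (v j) ∧ e.1 a = u j := fun j => by
          have := hi j
          simp only [φ, Function.comp_apply, hw, Option.elim_some, Option.map_eq_some_iff] at this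
          obtain ⟨a, ha, hau⟩ := this
          exact ⟨a, (hinv a _).1 ha, hau⟩
        choose a ha hau using h
        refine hu a ha ?_
        rw [← e.2.2 n a]
        congr 1
        exact funext fun j => (hau j).symm
    by_cases hex : ∃ u, Inf n (φ ∘ v) u
    · simp only [c', dif_pos hex]
      rw [huniq _ hex.choose_spec]
    · have hv : ¬ Inf n (φ ∘ v) v := fun h => hex ⟨v, h⟩
      obtain ⟨i, hi⟩ := l.proper
      have hcol : ∃ a : Fin n → A, (∀ j, s (a j) = ((φ ∘ v) j).1) ∧ c n v = cA n a := by
        by_contra hno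
        push Not at hno
        exact hv ⟨⟨i, fun j => by simp [φ, hi]⟩, hno⟩
      obtain ⟨a, ha, hca⟩ := hcol
      have hexa : ∃ a : Fin n → A, ∀ j, s (a j) = ((φ ∘ v) j).1 := ⟨a, ha⟩
      have heq : hexa.choose = a :=
        funext fun j => hs ((hexa.choose_spec j).trans (ha j).symm)
      simp only [c', dif_neg hex, dif_pos hexa]
      rw [heq, hca]
  · rw [← hl ⟨e, he, hc⟩]
    dsimp only
    congr 1
    funext a
    refine Prod.ext (he a) (funext fun i => ?_)
    have hsa : Function.partialInv s (π (e a)) = some a := (hinv a _).2 (he a).symm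
    rcases hw : l.idxFun i with _ | e' <;> simp [φ, hw, hsa]

/-- The partite construction over finitely many transversals. -/
theorem exists_partite_extension_finset {κ : ℕ → Type*} [∀ n, Inhabited (κ n)] {A : Type*}
    [Finite A] (cA : ∀ n, (Fin n → A) → κ n) {I : Type} [Finite I] (T : Finset (A ↪ I)) :
    ∀ (P : Type) [Finite P] (π : P → I) (c : ∀ n, (Fin n → P) → κ n),
    ∃ (P' : Type) (_ : Finite P') (π' : P' → I) (c' : ∀ n, (Fin n → P') → κ n),
      ∀ χ : (A → P') → Fin 2, ∃ φ : P → P', (∀ p, π' (φ p) = π p) ∧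
        (∀ n v, c' n (φ ∘ v) = c n v) ∧
        ∀ s ∈ T, ∃ k, ∀ e : A → P, (∀ a, π (e a) = s a) → (∀ n v, c n (e ∘ v) = cA n v) →
          χ (φ ∘ e) = k := by
  classical
  induction T using Finset.induction_on with
  | empty =>
    exact fun P _ π c => ⟨P, ‹_›, π, c, fun χ => ⟨id, fun _ => rfl, fun _ _ => rfl, by simp⟩⟩
  | insert s T _ ih =>
    intro P _ π c
    obtain ⟨P₁, _, π₁, c₁, h₁⟩ := exists_partite_extension cA π c s s.injective
    obtain ⟨P₂, _, π₂, c₂, h₂⟩ := ih P₁ π₁ c₁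
    refine ⟨P₂, ‹_›, π₂, c₂, fun χ => ?_⟩
    obtain ⟨ψ, hψ, hcψ, hT⟩ := h₂ χ
    obtain ⟨φ, hφ, hcφ, k, hk⟩ := h₁ fun e => χ (ψ ∘ e)
    refine ⟨ψ ∘ φ, fun p => (hψ _).trans (hφ p),
      fun n v => (hcψ n (φ ∘ v)).trans (hcφ n v), fun t ht => ?_⟩
    rcases Finset.mem_insert.1 ht with rfl | ht
    · exact ⟨k, hk⟩
    · obtain ⟨k', hk'⟩ := hT t ht
      exact ⟨k', fun e he hc => hk' (φ ∘ e) (fun a => (hφ _).trans (he a))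
        fun n v => (hcφ n (e ∘ v)).trans (hc n v)⟩

/-! ### From tuple colourings to ordered structures -/

/-- The linear order of an ordered structure. -/
@[reducible] noncomputable def IsOrderedStructure.linearOrder {L : FirstOrder.Language}
    [L.IsOrdered] {M : Type*} [L.Structure M] (h : IsOrderedStructure L M) : LinearOrder M where
  le x y := RelMap (leSymb : L.Relations 2) ![x, y]
  le_refl := h.refl
  le_trans := h.trans
  le_antisymm := h.antisymm
  le_total := h.total
  toDecidableLE := Classical.decRel _

/-- The structure on a linear order in which `≤` is interpreted by the order and every other
relation symbol is read off from a colouring of tuples by sets of relation symbols. -/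
@[reducible] def coloredStructure (L : FirstOrder.Language) [L.IsRelational] [L.IsOrdered]
    (M : Type*) [LE M] (c : ∀ n, (Fin n → M) → Set (L.Relations n)) : L.Structure M where
  funMap f := isEmptyElim f
  RelMap {n} r v := (∃ x y : M, x ≤ y ∧
      (⟨n, r, v⟩ : Σ n, L.Relations n × (Fin n → M)) = ⟨2, leSymb, ![x, y]⟩) ∨
    ((⟨n, r⟩ : Σ n, L.Relations n) ≠ ⟨2, leSymb⟩ ∧ r ∈ c n v)

theorem coloredStructure_relMap_leSymb (L : FirstOrder.Language) [L.IsRelational] [L.IsOrdered]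
    {M : Type*} [LE M] (c : ∀ n, (Fin n → M) → Set (L.Relations n)) (v : Fin 2 → M) :
    (coloredStructure L M c).RelMap (leSymb : L.Relations 2) v ↔ v 0 ≤ v 1 := by
  constructor
  · rintro (⟨x, y, hxy, h⟩ | ⟨h, -⟩)
    · simp only [Sigma.mk.injEq, heq_eq_eq, Prod.mk.injEq, true_and] at h
      simpa [h] using hxy
    · exact absurd rfl h
  · refine fun h => Or.inl ⟨v 0, v 1, h, ?_⟩
    have : v = ![v 0, v 1] := by ext i; fin_cases i <;> rfl
    rw [← this]

theorem coloredStructure_relMap_of_ne (L : FirstOrder.Language) [L.IsRelational] [L.IsOrdered]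
    {M : Type*} [LE M] (c : ∀ n, (Fin n → M) → Set (L.Relations n)) {n : ℕ} (r : L.Relations n)
    (hr : (⟨n, r⟩ : Σ n, L.Relations n) ≠ ⟨2, leSymb⟩) (v : Fin n → M) :
    (coloredStructure L M c).RelMap r v ↔ r ∈ c n v := by
  constructor
  · rintro (⟨x, y, -, h⟩ | ⟨-, h⟩)
    · exact absurd (congrArg (fun z : Σ n, L.Relations n × (Fin n → M) =>
        (⟨z.1, z.2.1⟩ : Σ n, L.Relations n)) h) hr
    · exact h
  · exact fun h => Or.inr ⟨hr, h⟩

/-- The colouring of tuples that a structure gives rise to. -/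
def tupleColor (L : FirstOrder.Language) (M : Type*) [L.Structure M] (n : ℕ)
    (v : Fin n → M) : Set (L.Relations n) :=
  {r | RelMap r v}

theorem tupleColor_comp {L : FirstOrder.Language} {A B : Type*} [L.Structure A] [L.Structure B]
    (g : A ↪[L] B) (n : ℕ) (v : Fin n → A) : tupleColor L B n (g ∘ v) = tupleColor L A n v :=
  Set.ext fun r => g.map_rel r v

/-- The Nešetřil–Rödl and Abramson–Harrington theorem: finite ordered structures have the
Ramsey property for colourings of embeddings. -/
theorem exists_partitionArrow (L : FirstOrder.Language) [L.IsRelational] [L.IsOrdered]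
    (A B : Type*) [L.Structure A] [L.Structure B] [Finite A] [Finite B]
    (hA : IsOrderedStructure L A)
    (hB : IsOrderedStructure L B) :
    ∃ (C : Type) (_ : L.Structure C), Finite C ∧
      IsOrderedStructure L C ∧
      PartitionArrow L C B A := by
  classical
  let := hA.linearOrder
  let := hB.linearOrder
  let := Fintype.ofFinite A
  let := Fintype.ofFinite B
  obtain ⟨N, hN⟩ := exists_monochromatic_orderEmbedding A B
  let b := (Fintype.orderIsoFinOfCardEq B rfl).symm
  obtain ⟨C, _, π, c, hC⟩ := exists_partite_extension_finset (tupleColor L A)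
    (Finset.univ : Finset (A ↪ Fin N)) ((Fin (Fintype.card B) ↪o Fin N) × Fin (Fintype.card B))
    (fun p => p.1 p.2) (fun n v => tupleColor L B n fun j => b.symm (v j).2)
  obtain ⟨m, ⟨eC⟩⟩ := Finite.exists_equiv_fin C
  -- Ordering by projection first makes every lift of an order embedding monotone; ties are broken
  -- arbitrarily.
  let key : C → Fin N ×ₗ Fin m := fun x => toLex (π x, eC x)
  have hkey : Function.Injective key := fun x y h => by
    simpa [key] using (congrArg (fun z => (ofLex z).2) h)
  let : LinearOrder C := LinearOrder.lift' key hkey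
  have hlt : ∀ x y : C, π x < π y → x < y := fun x y h => by
    change key x < key y
    exact Prod.Lex.toLex_lt_toLex.2 (Or.inl h)
  let := coloredStructure L C c
  have hle : ∀ v : Fin 2 → C, RelMap (leSymb : L.Relations 2) v ↔ v 0 ≤ v 1 :=
    coloredStructure_relMap_leSymb L c
  refine ⟨C, inferInstance, inferInstance, ?_, fun χ => ?_⟩
  · have : (fun x y : C => RelMap (leSymb : L.Relations 2) ![x, y]) = (· ≤ ·) := by
      funext x y
      exact propext (hle _)
    rw [IsOrderedStructure, this]
    infer_instance
  -- Maps that are not embeddings get the dummy colour 0.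
  obtain ⟨φ, hφ, hcφ, hk⟩ := hC fun f => if h : ∃ g : A ↪[L] C, ⇑g = f then χ h.choose else 0
  choose k hk using fun s => hk s (Finset.mem_univ s)
  obtain ⟨t, k₀, ht⟩ := hN fun s => k s.toEmbedding
  let f₀ (y : B) : C := φ (b.symm.toOrderEmbedding.trans t, b y)
  have hπ : ∀ y, π (f₀ y) = t y := fun y => by simp [f₀, hφ]
  have hmono : StrictMono f₀ := fun x y h => hlt _ _ (by simpa [hπ] using h)
  have hcol : ∀ n (v : Fin n → B), c n (f₀ ∘ v) = tupleColor L B n v := fun n v => by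
    have := hcφ n fun j => (b.symm.toOrderEmbedding.trans t, b (v j))
    refine this.trans (congrArg _ (funext fun j => ?_))
    simp
  let f : B ↪[L] C :=
    { toFun := f₀
      inj' := hmono.injective
      map_fun' := fun g => isEmptyElim g
      map_rel' := fun {n} r v => by
        by_cases hr : (⟨n, r⟩ : Σ n, L.Relations n) = ⟨2, leSymb⟩
        · cases hr
          rw [hle]
          have hv : v = ![v 0, v 1] := by ext i; fin_cases i <;> rfl
          refine (hmono.le_iff_le (a := v 0) (b := v 1)).trans ?_
          conv_rhs => rw [hv]
          exact Iff.rfl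
        · refine (coloredStructure_relMap_of_ne L c r hr _).trans ?_
          rw [hcol]
          exact Iff.rfl }
  refine ⟨f, k₀, fun g => ?_⟩
  have hgle : ∀ x y : A, g x ≤ g y ↔ x ≤ y := fun x y => by
    have h := g.map_rel (leSymb : L.Relations 2) ![x, y]
    have hv : g ∘ ![x, y] = ![g x, g y] := by ext i; fin_cases i <;> rfl
    rw [hv] at h
    exact h
  let g' : A ↪o B := ⟨⟨g, g.injective⟩, hgle _ _⟩
  rw [← ht g', ← hk (g'.trans t).toEmbedding
    (fun a => (b.symm.toOrderEmbedding.trans t, b (g a)))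
    (fun a => by simp [g']) (fun n v => by
      refine Eq.trans (congrArg _ (funext fun j => ?_)) (tupleColor_comp g n v)
      simp)]
  have hex : ∃ h : A ↪[L] C, ⇑h = φ ∘ fun a => (b.symm.toOrderEmbedding.trans t, b (g a)) :=
    ⟨f.comp g, rfl⟩
  rw [dif_pos hex]
  congr 1
  exact DFunLike.coe_injective hex.choose_spec.symm

end StructuralRamsey

theorem mainTheorem8 (L : FirstOrder.Language) [L.IsRelational] [L.IsOrdered]
    (A B : Type*) [L.Structure A] [L.Structure B] [Finite A] [Finite B]
    (hA : StructuralRamsey.IsOrderedStructure L A)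
    (hB : StructuralRamsey.IsOrderedStructure L B) :
    ∃ (C : Type) (_ : L.Structure C), Finite C ∧
      StructuralRamsey.IsOrderedStructure L C ∧
      StructuralRamsey.PartitionArrow L C B A :=
  StructuralRamsey.exists_partitionArrow L A B hA hB
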